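/- Let $R$ be a commutative ring with unit and let $E=(E^0,E^1,r,s)$ be an arbitrary directed graph. A vertex $v$ is regular if $s^{-1}(v)$ is finite and nonempty; a path is either a vertex (length $0$) or a finite sequence of edges $e_1\cdots e_n$ with $r(e_i)=s(e_{i+1})$. The Leavitt path algebra $L_R(E)$ is the universal (not necessarily unital) associative $R$-algebra generated by pairwise orthogonal idempotents $v\in E^0$ and elements $e,e^*$ ($e\in E^1$) subject to (1) $s(e)e=e=e\,r(e)$ for all $e \in E^1$; (2) $r(e)e^*=e^*=e^*s(e)$ for all $e\in E^1$; (3) $e^*e=r(e)$ and $e^*f=0$ for all $e\neq f$ in $E^1$; (4) $v=\sum_{s(e)=v}ee^*$ for every regular vertex $v$. The Cohn path algebra $C_R(E)$ is defined in the same way, with relation (4) omitted. Both carry the $R$-linear involution fixing the vertices and exchanging $e$ and $e^*$. The commutative core $M_R(E)\subseteq L_R(E)$ is the $R$-subalgebra generated by all elements $\alpha\beta^*$, with $\alpha,\beta$ paths and $r(\alpha)=r(\beta)$, that are normal, i.e. commute with $(\alpha\beta^*)^*=\beta\alpha^*$. The graph $F(E)$ is obtained from $E$ by adding a new vertex $v'$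 for each regular vertex $v$ of $E$, and a new edge $e'$ with $s(e')=s(e)$ and $r(e')=r(e)'$ for each edge $e$ such that $r(e)$ is regular in $E$. There is an isomorphism $C_R(E)\cong L_R(F(E))$ of $R$-algebras with involution given by $v\mapsto v+v'$ and $e\mapsto e+e'$, where primed symbols that do not exist are read as $0$. Through this isomorphism we regard the vertices of $F(E)$ and the commutative core $M_R(F(E))$ as contained in $C_R(E)$. Thus, in $C_R(E)$, for a vertex $v$ regular in $E$ the vertices $v$ and $v'$ of $F(E)$ become $\sum_{s(e)=v}ee^*$ and $v-\sum_{s(e)=v}ee^*$, and a nonregular vertex $v$ becomes $v$. **Corollary (uniqueness theorem for Cohn path algebras).** Let $\Phi:C_R(E)\to\mathcal A$ be a ring homomorphism into a ring $\mathcal A$ (rings need not be unital, and $\Phi$ need not be $R$-linear). The following conditions are equivalent: (i) $\Phi$ is injective; (ii) the restriction of $\Phi$ to $M_R(F(E))$ is injective; (iii) $\Phi(rv)\neq 0$ for all $v\in F(E)^0$ and all $r\in R\setminus\{0\}$. -/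

import Mathlib

universe u v w

/-- A directed graph with vertex set `V`, edge set `E`, and source and range maps `s`, `r`.
Loops, parallel edges, and infinitely many vertices or edges are allowed. -/
structure DirGraph (V : Type u) (E : Type v) where
  s : E → V
  r : E → V

namespace DirGraph

section Graphs

variable {V : Type u} {E : Type v}

/-- A vertex is regular if it emits a finite nonzero number of edges. -/
def IsRegular (G : DirGraph V E) (x : V) : Prop :=
  {e | G.s e = x}.Finite ∧ {e | G.s e = x}.Nonempty

/-- `G.IsPath x l y`: the edges in the list `l`, in this order, form a path from `x` to `y`.
The empty list is the path of length zero at `x`. -/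
def IsPath (G : DirGraph V E) : V → List E → V → Prop
  | x, [], y => x = y
  | x, e :: l, y => G.s e = x ∧ G.IsPath (G.r e) l y

/-- The graph `F(G)`: add a new vertex `v'` (here `Sum.inr v`) for every regular vertex `v`, and a
new edge `e'` (here `Sum.inr e`) from `s(e)` to `r(e)'` for every edge `e` with `r(e)` regular. -/
def F (G : DirGraph V E) :
    DirGraph (V ⊕ {x : V // G.IsRegular x}) (E ⊕ {e : E // G.IsRegular (G.r e)}) where
  s := Sum.elim (fun e => Sum.inl (G.s e)) (fun e => Sum.inl (G.s e.1))
  r := Sum.elim (fun e => Sum.inl (G.r e)) (fun e => Sum.inr ⟨G.r e.1, e.2⟩)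

end Graphs

/-- The generators of a path algebra: vertices, edges, and ghost edges `e*`. -/
inductive Gen (V : Type u) (E : Type v) : Type (max u v)
  | vertex (x : V) : Gen V E
  | edge (e : E) : Gen V E
  | ghost (e : E) : Gen V E

/-- The free associative (non-unital) `R`-algebra on vertices, edges and ghost edges. -/
abbrev FreeAlg (R : Type w) [CommRing R] (V : Type u) (E : Type v) : Type (max u v w) :=
  MonoidAlgebra R (FreeSemigroup (Gen V E))

/-- A generator as an element of the free algebra. -/
noncomputable def gen (R : Type w) [CommRing R] {V : Type u} {E : Type v} (g : Gen V E) :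
    FreeAlg R V E :=
  MonoidAlgebra.single (FreeSemigroup.of g) 1

section Relations

variable (R : Type w) [CommRing R] {V : Type u} {E : Type v} (G : DirGraph V E) (X : Set V)

open Gen in
/-- The defining relations: the vertices are pairwise orthogonal idempotents, `s(e) e = e = e r(e)`,
`r(e) e* = e* = e* s(e)`, the (CK-1) relations `e* e = r(e)` and `e* f = 0` for `e ≠ f`, and the
(CK-2) relation `v = ∑ e e*` (sum over `s(e) = v`) at every regular vertex `v` belonging to `X`. -/
inductive BaseRel : FreeAlg R V E → FreeAlg R V E → Prop
  | vertex_idem (x : V) :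
      BaseRel (gen R (vertex x) * gen R (vertex x)) (gen R (vertex x))
  | vertex_orth (x y : V) (h : x ≠ y) :
      BaseRel (gen R (vertex x) * gen R (vertex y)) 0
  | s_edge (e : E) : BaseRel (gen R (vertex (G.s e)) * gen R (edge e)) (gen R (edge e))
  | edge_r (e : E) : BaseRel (gen R (edge e) * gen R (vertex (G.r e))) (gen R (edge e))
  | r_ghost (e : E) : BaseRel (gen R (vertex (G.r e)) * gen R (ghost e)) (gen R (ghost e))
  | ghost_s (e : E) : BaseRel (gen R (ghost e) * gen R (vertex (G.s e))) (gen R (ghost e))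
  | ck1_same (e : E) : BaseRel (gen R (ghost e) * gen R (edge e)) (gen R (vertex (G.r e)))
  | ck1_diff (e f : E) (h : e ≠ f) : BaseRel (gen R (ghost e) * gen R (edge f)) 0
  | ck2 (x : V) (hX : x ∈ X) (hx : G.IsRegular x) :
      BaseRel (gen R (vertex x)) (∑ e ∈ hx.1.toFinset, gen R (edge e) * gen R (ghost e))

/-- The smallest congruence of non-unital `R`-algebras containing the defining relations. -/
inductive CongRel : FreeAlg R V E → FreeAlg R V E → Prop
  | of {a b : FreeAlg R V E} (h : BaseRel R G X a b) : CongRel a b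
  | refl (a : FreeAlg R V E) : CongRel a a
  | symm {a b : FreeAlg R V E} (h : CongRel a b) : CongRel b a
  | trans {a b c : FreeAlg R V E} (h : CongRel a b) (h' : CongRel b c) : CongRel a c
  | add {a b c d : FreeAlg R V E} (h : CongRel a b) (h' : CongRel c d) : CongRel (a + c) (b + d)
  | mul {a b c d : FreeAlg R V E} (h : CongRel a b) (h' : CongRel c d) : CongRel (a * c) (b * d)
  | smul (t : R) {a b : FreeAlg R V E} (h : CongRel a b) : CongRel (t • a) (t • b)

/-- `CongRel` as a bundled ring congruence. -/
noncomputable def pathCon : RingCon (FreeAlg R V E) where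
  r := CongRel R G X
  iseqv := ⟨CongRel.refl, CongRel.symm, CongRel.trans⟩
  add' := CongRel.add
  mul' := CongRel.mul

/-- The universal (non-unital) associative `R`-algebra generated by the vertices, edges and ghost
edges of `G`, with the (CK-2) relation imposed exactly at the regular vertices lying in `X`. -/
def PathAlgebra : Type (max u v w) := (pathCon R G X).Quotient

/-- The Leavitt path algebra `L_R(G)`: (CK-2) holds at all regular vertices. -/
abbrev Leavitt : Type (max u v w) := PathAlgebra R G Set.univ

/-- The Cohn path algebra `C_R(G)`: (CK-2) is not imposed. -/
abbrev Cohn : Type (max u v w) := PathAlgebra R G ∅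

end Relations

namespace PathAlgebra

section Structure

variable {R : Type w} [CommRing R] {V : Type u} {E : Type v} {G : DirGraph V E} {X : Set V}

noncomputable instance : NonUnitalRing (PathAlgebra R G X) :=
  inferInstanceAs (NonUnitalRing (pathCon R G X).Quotient)

/-- The quotient map from the free algebra. -/
noncomputable def mk : FreeAlg R V E → PathAlgebra R G X := fun a => (a : (pathCon R G X).Quotient)

theorem mk_surjective : Function.Surjective (mk : FreeAlg R V E → PathAlgebra R G X) :=
  Quotient.mk''_surjective

theorem mk_eq {a b : FreeAlg R V E} (h : CongRel R G X a b) :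
    (mk a : PathAlgebra R G X) = mk b := (RingCon.eq _).2 h

theorem mk_add (a b : FreeAlg R V E) : (mk (a + b) : PathAlgebra R G X) = mk a + mk b := rfl

theorem mk_mul (a b : FreeAlg R V E) : (mk (a * b) : PathAlgebra R G X) = mk a * mk b := rfl

theorem mk_zero : (mk 0 : PathAlgebra R G X) = 0 := rfl

noncomputable instance : SMul R (PathAlgebra R G X) where
  smul t := Quotient.map' (fun a => t • a) (fun _ _ h => CongRel.smul t h)

theorem mk_smul (t : R) (a : FreeAlg R V E) : (mk (t • a) : PathAlgebra R G X) = t • mk a := rfl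

/-- The quotient map as an additive homomorphism. -/
noncomputable def mkAddHom : FreeAlg R V E →+ PathAlgebra R G X where
  toFun := mk
  map_zero' := mk_zero
  map_add' := mk_add

noncomputable instance : Module R (PathAlgebra R G X) :=
  Function.Surjective.module R mkAddHom mk_surjective mk_smul

instance : IsScalarTower R (PathAlgebra R G X) (PathAlgebra R G X) where
  smul_assoc t a b := by
    obtain ⟨a, rfl⟩ := mk_surjective a
    obtain ⟨b, rfl⟩ := mk_surjective b
    simp only [smul_eq_mul, ← mk_smul, ← mk_mul, smul_mul_assoc]

instance : SMulCommClass R (PathAlgebra R G X) (PathAlgebra R G X) where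
  smul_comm t a b := by
    obtain ⟨a, rfl⟩ := mk_surjective a
    obtain ⟨b, rfl⟩ := mk_surjective b
    simp only [smul_eq_mul, ← mk_smul, ← mk_mul, mul_smul_comm]

/-- The quotient map as a homomorphism of non-unital algebras. -/
noncomputable def mkHom : FreeAlg R V E →ₙₐ[R] PathAlgebra R G X where
  toFun := mk
  map_zero' := mk_zero
  map_add' := mk_add
  map_mul' := mk_mul
  map_smul' := mk_smul

variable (R G X) in
/-- A vertex as an element of the algebra. -/
noncomputable def vertex (x : V) : PathAlgebra R G X := mk (gen R (Gen.vertex x))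

variable (R G X) in
/-- An edge as an element of the algebra. -/
noncomputable def edge (e : E) : PathAlgebra R G X := mk (gen R (Gen.edge e))

variable (R G X) in
/-- A ghost edge `e*` as an element of the algebra. -/
noncomputable def ghost (e : E) : PathAlgebra R G X := mk (gen R (Gen.ghost e))

theorem mk_sum {ι : Type*} (t : Finset ι) (f : ι → FreeAlg R V E) :
    (mk (∑ i ∈ t, f i) : PathAlgebra R G X) = ∑ i ∈ t, mk (f i) := map_sum mkAddHom f t

@[simp] theorem vertex_mul_self (x : V) : vertex R G X x * vertex R G X x = vertex R G X x :=
  mk_eq (.of (.vertex_idem x))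

theorem vertex_mul_of_ne {x y : V} (h : x ≠ y) : vertex R G X x * vertex R G X y = 0 :=
  mk_eq (.of (.vertex_orth x y h))

@[simp] theorem s_mul_edge (e : E) : vertex R G X (G.s e) * edge R G X e = edge R G X e :=
  mk_eq (.of (.s_edge e))

@[simp] theorem edge_mul_r (e : E) : edge R G X e * vertex R G X (G.r e) = edge R G X e :=
  mk_eq (.of (.edge_r e))

@[simp] theorem r_mul_ghost (e : E) : vertex R G X (G.r e) * ghost R G X e = ghost R G X e :=
  mk_eq (.of (.r_ghost e))

@[simp] theorem ghost_mul_s (e : E) : ghost R G X e * vertex R G X (G.s e) = ghost R G X e :=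
  mk_eq (.of (.ghost_s e))

@[simp] theorem ghost_mul_edge (e : E) :
    ghost R G X e * edge R G X e = vertex R G X (G.r e) :=
  mk_eq (.of (.ck1_same e))

theorem ghost_mul_edge_of_ne {e f : E} (h : e ≠ f) : ghost R G X e * edge R G X f = 0 :=
  mk_eq (.of (.ck1_diff e f h))

theorem vertex_eq_sum {x : V} (hX : x ∈ X) (hx : G.IsRegular x) :
    vertex R G X x = ∑ e ∈ hx.1.toFinset, edge R G X e * ghost R G X e :=
  (mk_eq (.of (.ck2 x hX hx))).trans (mk_sum _ _)

end Structure

section Lift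

variable {R : Type w} [CommRing R] {V : Type u} {E : Type v} {G : DirGraph V E} {X : Set V}
variable {A : Type*} [NonUnitalRing A] [Module R A] [IsScalarTower R A A] [SMulCommClass R A A]

variable (G X) in
/-- A family of elements of `A` satisfying the defining relations. -/
structure IsFamily (p : V → A) (a b : E → A) : Prop where
  vertex_idem (x : V) : p x * p x = p x
  vertex_orth (x y : V) (h : x ≠ y) : p x * p y = 0
  s_edge (e : E) : p (G.s e) * a e = a e
  edge_r (e : E) : a e * p (G.r e) = a e
  r_ghost (e : E) : p (G.r e) * b e = b e
  ghost_s (e : E) : b e * p (G.s e) = b e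
  ck1_same (e : E) : b e * a e = p (G.r e)
  ck1_diff (e f : E) (h : e ≠ f) : b e * a f = 0
  ck2 (x : V) (hX : x ∈ X) (hx : G.IsRegular x) : p x = ∑ e ∈ hx.1.toFinset, a e * b e

/-- The homomorphism out of the free algebra given by the images of the generators. -/
noncomputable def freeLift (p : V → A) (a b : E → A) : FreeAlg R V E →ₙₐ[R] A :=
  MonoidAlgebra.liftMagma R (FreeSemigroup.lift (fun g : Gen V E =>
    match g with
    | .vertex x => p x
    | .edge e => a e
    | .ghost e => b e))

theorem freeLift_vertex (p : V → A) (a b : E → A) (x : V) :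
    freeLift p a b (gen R (Gen.vertex x)) = p x := by
  simp [freeLift, gen]

theorem freeLift_edge (p : V → A) (a b : E → A) (e : E) :
    freeLift p a b (gen R (Gen.edge e)) = a e := by
  simp [freeLift, gen]

theorem freeLift_ghost (p : V → A) (a b : E → A) (e : E) :
    freeLift p a b (gen R (Gen.ghost e)) = b e := by
  simp [freeLift, gen]

theorem freeLift_congRel {p : V → A} {a b : E → A} (h : IsFamily G X p a b)
    {y z : FreeAlg R V E} (hyz : CongRel R G X y z) :
    freeLift p a b y = freeLift p a b z := by
  induction hyz with
  | of h' =>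
    cases h' <;>
      simp only [map_mul, map_sum, map_zero, freeLift_vertex, freeLift_edge, freeLift_ghost]
    · exact h.vertex_idem _
    · exact h.vertex_orth _ _ ‹_›
    · exact h.s_edge _
    · exact h.edge_r _
    · exact h.r_ghost _
    · exact h.ghost_s _
    · exact h.ck1_same _
    · exact h.ck1_diff _ _ ‹_›
    · exact h.ck2 _ ‹_› ‹_›
  | refl => rfl
  | symm _ ih => exact ih.symm
  | trans _ _ ih ih' => exact ih.trans ih'
  | add _ _ ih ih' => rw [map_add, map_add, ih, ih']
  | mul _ _ ih ih' => rw [map_mul, map_mul, ih, ih']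
  | smul t _ ih => rw [map_smul, map_smul, ih]

/-- The universal property: the homomorphism given by a family satisfying the relations. -/
noncomputable def lift {p : V → A} {a b : E → A} (h : IsFamily G X p a b) :
    PathAlgebra R G X →ₙₐ[R] A where
  toFun := Quotient.lift (freeLift (R := R) p a b) (fun _ _ hyz => freeLift_congRel h hyz)
  map_zero' := map_zero (freeLift (R := R) p a b)
  map_add' y z := by
    obtain ⟨y, rfl⟩ := mk_surjective y
    obtain ⟨z, rfl⟩ := mk_surjective z
    exact map_add (freeLift (R := R) p a b) y z
  map_mul' y z := by
    obtain ⟨y, rfl⟩ := mk_surjective y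
    obtain ⟨z, rfl⟩ := mk_surjective z
    exact map_mul (freeLift (R := R) p a b) y z
  map_smul' t y := by
    obtain ⟨y, rfl⟩ := mk_surjective y
    exact map_smul (freeLift (R := R) p a b) t y

section

variable {p : V → A} {a b : E → A} (h : IsFamily G X p a b)

@[simp] theorem lift_vertex (x : V) : lift h (vertex R G X x) = p x := freeLift_vertex p a b x

@[simp] theorem lift_edge (e : E) : lift h (edge R G X e) = a e := freeLift_edge p a b e

@[simp] theorem lift_ghost (e : E) : lift h (ghost R G X e) = b e := freeLift_ghost p a b e

end

end Lift

section Ext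

variable {R : Type w} [CommRing R] {V : Type u} {E : Type v} {G : DirGraph V E} {X : Set V}
variable {A : Type*} [NonUnitalRing A] [Module R A]

theorem hom_ext {f g : PathAlgebra R G X →ₙₐ[R] A}
    (hv : ∀ x, f (vertex R G X x) = g (vertex R G X x))
    (he : ∀ e, f (edge R G X e) = g (edge R G X e))
    (hg : ∀ e, f (ghost R G X e) = g (ghost R G X e)) : f = g := by
  have key : f.comp mkHom = g.comp mkHom := by
    apply MonoidAlgebra.nonUnitalAlgHom_ext'
    apply FreeSemigroup.hom_ext
    funext y
    cases y with
    | vertex x => exact hv x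
    | edge e => exact he e
    | ghost e => exact hg e
  ext y
  obtain ⟨y, rfl⟩ := mk_surjective y
  exact DFunLike.congr_fun key y


end Ext

section Involution

variable {R : Type w} [CommRing R] {V : Type u} {E : Type v} {G : DirGraph V E} {X : Set V}

open MulOpposite

theorem isFamily_op : IsFamily G X (fun x => op (vertex R G X x))
    (fun e => op (ghost R G X e)) (fun e => op (edge R G X e)) where
  vertex_idem x := by rw [← op_mul, vertex_mul_self]
  vertex_orth x y h := by rw [← op_mul, vertex_mul_of_ne h.symm, op_zero]
  s_edge e := by rw [← op_mul, ghost_mul_s]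
  edge_r e := by rw [← op_mul, r_mul_ghost]
  r_ghost e := by rw [← op_mul, edge_mul_r]
  ghost_s e := by rw [← op_mul, s_mul_edge]
  ck1_same e := by rw [← op_mul, ghost_mul_edge]
  ck1_diff e f h := by rw [← op_mul, ghost_mul_edge_of_ne h.symm, op_zero]
  ck2 x hX hx := by simp only [← op_mul, ← Finset.op_sum, ← vertex_eq_sum hX hx]

/-- The involution as a homomorphism into the opposite algebra. -/
noncomputable def starHom : PathAlgebra R G X →ₙₐ[R] (PathAlgebra R G X)ᵐᵒᵖ := lift isFamily_op

theorem unop_starHom_unop_starHom (y : PathAlgebra R G X) :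
    unop (starHom (unop (starHom y))) = y := by
  let f : PathAlgebra R G X →ₙₐ[R] PathAlgebra R G X :=
    { toFun := fun y => unop (starHom (unop (starHom y)))
      map_zero' := by simp
      map_add' := by simp
      map_mul' := by simp
      map_smul' := by simp }
  have hf : f = NonUnitalAlgHom.id R (PathAlgebra R G X) := by
    apply hom_ext <;> intro x <;> simp [f, starHom]
  exact DFunLike.congr_fun hf y

/-- The `R`-linear involution fixing vertices and exchanging `e` and `e*`. -/
noncomputable instance : StarRing (PathAlgebra R G X) where
  star y := unop (starHom y)
  star_involutive := unop_starHom_unop_starHom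
  star_mul := by simp
  star_add := by simp

theorem star_def (y : PathAlgebra R G X) : star y = unop (starHom y) := rfl

@[simp] theorem star_vertex (x : V) : star (vertex R G X x) = vertex R G X x := by
  simp [star_def, starHom]

@[simp] theorem star_edge (e : E) : star (edge R G X e) = ghost R G X e := by
  simp [star_def, starHom]

@[simp] theorem star_ghost (e : E) : star (ghost R G X e) = edge R G X e := by
  simp [star_def, starHom]

theorem star_smul' (t : R) (y : PathAlgebra R G X) : star (t • y) = t • star y := by
  simp [star_def]

end Involution

end PathAlgebra

section Core

variable (R : Type w) [CommRing R] {V : Type u} {E : Type v} (G : DirGraph V E)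

open PathAlgebra

/-- The element of `L_R(G)` given by the path with source `x` and list of edges `l`: it is `x` if
the path has length zero and `e₁ ⋯ eₙ = e₁ ⋯ eₙ r(eₙ)` if `l = [e₁, …, eₙ]`. -/
noncomputable def pathElem : V → List E → Leavitt R G
  | x, [] => vertex R G Set.univ x
  | _, e :: l => edge R G Set.univ e * pathElem (G.r e) l

/-- The set of all normal elements of the form `αβ*`, with `α`, `β` paths and `r(α) = r(β)`. -/
def normalGenerators : Set (Leavitt R G) :=
  {y | ∃ (x x' z : V) (l l' : List E), G.IsPath x l z ∧ G.IsPath x' l' z ∧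
    y = pathElem R G x l * star (pathElem R G x' l') ∧ IsStarNormal y}

/-- The commutative core `M_R(G)`: the `R`-subalgebra of `L_R(G)` generated by the normal
generators `αβ*`. -/
noncomputable def commutativeCore : NonUnitalSubalgebra R (Leavitt R G) :=
  NonUnitalAlgebra.adjoin R (normalGenerators R G)

end Core

section CohnIso

variable (R : Type w) [CommRing R] {V : Type u} {E : Type v} (G : DirGraph V E)

open PathAlgebra

open scoped Classical in
/-- The element `v'` of `L_R(F(G))` if the vertex `v` of `G` is regular, otherwise `0`. -/
noncomputable def primeVertex (x : V) : Leavitt R G.F :=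
  if h : G.IsRegular x then vertex R G.F Set.univ (Sum.inr ⟨x, h⟩) else 0

open scoped Classical in
/-- The element `e'` of `L_R(F(G))` if `r(e)` is regular, otherwise `0`. -/
noncomputable def primeEdge (e : E) : Leavitt R G.F :=
  if h : G.IsRegular (G.r e) then edge R G.F Set.univ (Sum.inr ⟨e, h⟩) else 0

open scoped Classical in
/-- The element `(e')*` of `L_R(F(G))` if `r(e)` is regular, otherwise `0`. -/
noncomputable def primeGhost (e : E) : Leavitt R G.F :=
  if h : G.IsRegular (G.r e) then ghost R G.F Set.univ (Sum.inr ⟨e, h⟩) else 0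

variable {R G} in
theorem isFamily_to : IsFamily G ∅
    (fun x => vertex R G.F Set.univ (Sum.inl x) + primeVertex R G x)
    (fun e => edge R G.F Set.univ (Sum.inl e) + primeEdge R G e)
    (fun e => ghost R G.F Set.univ (Sum.inl e) + primeGhost R G e) := by
  have vv : ∀ x y, vertex R G.F Set.univ (Sum.inl x) * primeVertex R G y = 0 := by
    intro x y
    unfold primeVertex
    split_ifs
    · exact vertex_mul_of_ne (by simp)
    · simp
  have vv' : ∀ x y, primeVertex R G y * vertex R G.F Set.univ (Sum.inl x) = 0 := by
    intro x y
    unfold primeVertex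
    split_ifs
    · exact vertex_mul_of_ne (by simp)
    · simp
  have pp : ∀ x, primeVertex R G x * primeVertex R G x = primeVertex R G x := by
    intro x
    unfold primeVertex
    split_ifs <;> simp
  have pp' : ∀ x y, x ≠ y → primeVertex R G x * primeVertex R G y = 0 := by
    intro x y h
    unfold primeVertex
    split_ifs
    · exact vertex_mul_of_ne (by simpa using h)
    all_goals simp
  have se : ∀ e, vertex R G.F Set.univ (Sum.inl (G.s e)) * edge R G.F Set.univ (Sum.inl e) =
      edge R G.F Set.univ (Sum.inl e) := fun e => s_mul_edge (G := G.F) (Sum.inl e)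
  have er : ∀ e, edge R G.F Set.univ (Sum.inl e) * vertex R G.F Set.univ (Sum.inl (G.r e)) =
      edge R G.F Set.univ (Sum.inl e) := fun e => edge_mul_r (G := G.F) (Sum.inl e)
  have sg : ∀ e, ghost R G.F Set.univ (Sum.inl e) * vertex R G.F Set.univ (Sum.inl (G.s e)) =
      ghost R G.F Set.univ (Sum.inl e) := fun e => ghost_mul_s (G := G.F) (Sum.inl e)
  have gr : ∀ e, vertex R G.F Set.univ (Sum.inl (G.r e)) * ghost R G.F Set.univ (Sum.inl e) =
      ghost R G.F Set.univ (Sum.inl e) := fun e => r_mul_ghost (G := G.F) (Sum.inl e)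
  have se' : ∀ e, vertex R G.F Set.univ (Sum.inl (G.s e)) * primeEdge R G e =
      primeEdge R G e := by
    intro e
    unfold primeEdge
    split_ifs with h
    · exact s_mul_edge (G := G.F) (Sum.inr ⟨e, h⟩)
    · simp
  have er' : ∀ e, primeEdge R G e * primeVertex R G (G.r e) = primeEdge R G e := by
    intro e
    unfold primeEdge primeVertex
    split_ifs with h
    · exact edge_mul_r (G := G.F) (Sum.inr ⟨e, h⟩)
    · simp
  have sg' : ∀ e, primeGhost R G e * vertex R G.F Set.univ (Sum.inl (G.s e)) =
      primeGhost R G e := by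
    intro e
    unfold primeGhost
    split_ifs with h
    · exact ghost_mul_s (G := G.F) (Sum.inr ⟨e, h⟩)
    · simp
  have gr' : ∀ e, primeVertex R G (G.r e) * primeGhost R G e = primeGhost R G e := by
    intro e
    unfold primeGhost primeVertex
    split_ifs with h
    · exact r_mul_ghost (G := G.F) (Sum.inr ⟨e, h⟩)
    · simp
  have ge : ∀ e, ghost R G.F Set.univ (Sum.inl e) * edge R G.F Set.univ (Sum.inl e) =
      vertex R G.F Set.univ (Sum.inl (G.r e)) := fun e => ghost_mul_edge (G := G.F) (Sum.inl e)
  have ge' : ∀ e, primeGhost R G e * primeEdge R G e = primeVertex R G (G.r e) := by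
    intro e
    unfold primeGhost primeEdge primeVertex
    split_ifs with h
    · exact ghost_mul_edge (G := G.F) (Sum.inr ⟨e, h⟩)
    · simp
  have g1 : ∀ e f, ghost R G.F Set.univ (Sum.inl e) * primeEdge R G f = 0 := by
    intro e f
    unfold primeEdge
    split_ifs
    · exact ghost_mul_edge_of_ne (by simp)
    · simp
  have g2 : ∀ e f, primeGhost R G e * edge R G.F Set.univ (Sum.inl f) = 0 := by
    intro e f
    unfold primeGhost
    split_ifs
    · exact ghost_mul_edge_of_ne (by simp)
    · simp
  have g3 : ∀ e f, e ≠ f → primeGhost R G e * primeEdge R G f = 0 := by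
    intro e f h
    unfold primeGhost primeEdge
    split_ifs
    · exact ghost_mul_edge_of_ne (by simpa using h)
    all_goals simp
  refine ⟨fun x => ?_, fun x y h => ?_, fun e => ?_, fun e => ?_, fun e => ?_, fun e => ?_,
    fun e => ?_, fun e f h => ?_, fun x hX => absurd hX (Set.notMem_empty x)⟩
  · simp [add_mul, mul_add, vv, vv', pp]
  · simp [add_mul, mul_add, vv, vv', pp' x y h,
      vertex_mul_of_ne (X := Set.univ) (R := R) (G := G.F)
        (show Sum.inl x ≠ Sum.inl y by simpa using h)]
  · have h1 : primeVertex R G (G.s e) * edge R G.F Set.univ (Sum.inl e) = 0 := by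
      rw [← se e, ← mul_assoc, vv', zero_mul]
    have h2 : primeVertex R G (G.s e) * primeEdge R G e = 0 := by
      rw [← se' e, ← mul_assoc, vv', zero_mul]
    simp [add_mul, mul_add, se, se', h1, h2]
  · have h1 : edge R G.F Set.univ (Sum.inl e) * primeVertex R G (G.r e) = 0 := by
      rw [← er e, mul_assoc, vv, mul_zero]
    have h2 : primeEdge R G e * vertex R G.F Set.univ (Sum.inl (G.r e)) = 0 := by
      rw [← er' e, mul_assoc, vv', mul_zero]
    simp [add_mul, mul_add, er, er', h1, h2]
  · have h1 : primeVertex R G (G.r e) * ghost R G.F Set.univ (Sum.inl e) = 0 := by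
      rw [← gr e, ← mul_assoc, vv', zero_mul]
    have h2 : vertex R G.F Set.univ (Sum.inl (G.r e)) * primeGhost R G e = 0 := by
      rw [← gr' e, ← mul_assoc, vv, zero_mul]
    simp [add_mul, mul_add, gr, gr', h1, h2]
  · have h1 : ghost R G.F Set.univ (Sum.inl e) * primeVertex R G (G.s e) = 0 := by
      rw [← sg e, mul_assoc, vv, mul_zero]
    have h2 : primeGhost R G e * primeVertex R G (G.s e) = 0 := by
      rw [← sg' e, mul_assoc, vv, mul_zero]
    simp [add_mul, mul_add, sg, sg', h1, h2]
  · simp [add_mul, mul_add, ge, ge', g1, g2]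
  · simp [add_mul, mul_add, g1, g2, g3 e f h,
      ghost_mul_edge_of_ne (X := Set.univ) (R := R) (G := G.F)
        (show Sum.inl e ≠ Sum.inl f by simpa using h)]

/-- The homomorphism `C_R(G) → L_R(F(G))` with `v ↦ v + v'`, `e ↦ e + e'`, `e* ↦ e* + (e')*`, where
the primed symbols are read as `0` when they do not exist. -/
noncomputable def cohnToLeavitt : Cohn R G →ₙₐ[R] Leavitt R G.F := lift isFamily_to

open scoped Classical in
/-- For a vertex `v` of `G`: the sum of `e e*` over all edges `e` with source `v` in `C_R(G)` if `v`
is regular, and `v` otherwise. -/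
noncomputable def cohnSum (x : V) : Cohn R G :=
  if h : G.IsRegular x then ∑ e ∈ h.1.toFinset, edge R G ∅ e * ghost R G ∅ e
  else vertex R G ∅ x

/-- The images in `C_R(G)` of the vertices of `F(G)`. -/
noncomputable def ofVertex : V ⊕ {x : V // G.IsRegular x} → Cohn R G
  | Sum.inl x => cohnSum R G x
  | Sum.inr x => vertex R G ∅ x.1 - cohnSum R G x.1

/-- The images in `C_R(G)` of the edges of `F(G)`. -/
noncomputable def ofEdge : E ⊕ {e : E // G.IsRegular (G.r e)} → Cohn R G
  | Sum.inl e => edge R G ∅ e * cohnSum R G (G.r e)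
  | Sum.inr e => edge R G ∅ e.1 * (vertex R G ∅ (G.r e.1) - cohnSum R G (G.r e.1))

/-- The images in `C_R(G)` of the ghost edges of `F(G)`. -/
noncomputable def ofGhost : E ⊕ {e : E // G.IsRegular (G.r e)} → Cohn R G
  | Sum.inl e => cohnSum R G (G.r e) * ghost R G ∅ e
  | Sum.inr e => (vertex R G ∅ (G.r e.1) - cohnSum R G (G.r e.1)) * ghost R G ∅ e.1

variable {R G}

theorem vertex_mul_cohnSum (x : V) : vertex R G ∅ x * cohnSum R G x = cohnSum R G x := by
  unfold cohnSum
  split_ifs with h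
  · rw [Finset.mul_sum]
    refine Finset.sum_congr rfl fun e he => ?_
    have he : G.s e = x := by simpa using he
    rw [← mul_assoc, ← he, s_mul_edge]
  · simp

theorem cohnSum_mul_vertex (x : V) : cohnSum R G x * vertex R G ∅ x = cohnSum R G x := by
  unfold cohnSum
  split_ifs with h
  · rw [Finset.sum_mul]
    refine Finset.sum_congr rfl fun e he => ?_
    have he : G.s e = x := by simpa using he
    rw [mul_assoc, ← he, ghost_mul_s]
  · simp

theorem cohnSum_mul_edge (e : E) : cohnSum R G (G.s e) * edge R G ∅ e = edge R G ∅ e := by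
  unfold cohnSum
  split_ifs with h
  · rw [Finset.sum_mul, Finset.sum_eq_single e]
    · rw [mul_assoc, ghost_mul_edge, edge_mul_r]
    · intro f _ hf
      rw [mul_assoc, ghost_mul_edge_of_ne hf, mul_zero]
    · intro he
      simp at he
  · simp

theorem ghost_mul_cohnSum (e : E) : ghost R G ∅ e * cohnSum R G (G.s e) = ghost R G ∅ e := by
  unfold cohnSum
  split_ifs with h
  · rw [Finset.mul_sum, Finset.sum_eq_single e]
    · rw [← mul_assoc, ghost_mul_edge, r_mul_ghost]
    · intro f _ hf
      rw [← mul_assoc, ghost_mul_edge_of_ne hf.symm, zero_mul]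
    · intro he
      simp at he
  · simp

theorem cohnSum_mul_self (x : V) : cohnSum R G x * cohnSum R G x = cohnSum R G x := by
  conv_lhs => enter [2]; unfold cohnSum
  conv_rhs => unfold cohnSum
  split_ifs with h
  · rw [Finset.mul_sum]
    refine Finset.sum_congr rfl fun e he => ?_
    have he : G.s e = x := by simpa using he
    rw [← mul_assoc, ← he, cohnSum_mul_edge]
  · rw [cohnSum_mul_vertex, cohnSum, dif_neg h]

theorem cohnSum_of_not {x : V} (h : ¬ G.IsRegular x) : cohnSum R G x = vertex R G ∅ x :=
  dif_neg h

theorem cohnSum_of_isRegular {x : V} (h : G.IsRegular x) :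
    cohnSum R G x = ∑ e ∈ h.1.toFinset, edge R G ∅ e * ghost R G ∅ e :=
  dif_pos h

theorem isRegular_F_inl {x : V} (h : G.F.IsRegular (Sum.inl x)) : G.IsRegular x := by
  obtain ⟨h1, f, hf⟩ := h
  refine ⟨(h1.preimage Sum.inl_injective.injOn).subset fun e he => ?_, ?_⟩
  · exact congrArg Sum.inl he
  · rcases f with e | e
    · exact ⟨e, Sum.inl_injective hf⟩
    · exact ⟨e.1, Sum.inl_injective hf⟩

theorem not_isRegular_F_inr (x : {x : V // G.IsRegular x}) : ¬ G.F.IsRegular (Sum.inr x) := by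
  rintro ⟨-, f, hf⟩
  rcases f with e | e <;> cases hf

theorem IsRegular.F_inl {x : V} (h : G.IsRegular x) : G.F.IsRegular (Sum.inl x) := by
  obtain ⟨h1, e, he⟩ := h
  refine ⟨?_, Sum.inl e, congrArg Sum.inl he⟩
  refine ((h1.image Sum.inl).union ((h1.preimage Subtype.val_injective.injOn).image Sum.inr)).subset
    fun f hf => ?_
  rcases f with e | e
  · exact Or.inl ⟨e, Sum.inl_injective hf, rfl⟩
  · exact Or.inr ⟨e, Sum.inl_injective hf, rfl⟩

open scoped Classical in
theorem sum_F {M : Type*} [AddCommMonoid M] {x : V} (h : G.IsRegular x)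
    (h' : G.F.IsRegular (Sum.inl x)) (φ : E ⊕ {e : E // G.IsRegular (G.r e)} → M) :
    ∑ f ∈ h'.1.toFinset, φ f = ∑ e ∈ h.1.toFinset,
      (φ (Sum.inl e) + if he : G.IsRegular (G.r e) then φ (Sum.inr ⟨e, he⟩) else 0) := by
  have h2 : h'.1.toFinset = h.1.toFinset.disjSum (h.1.toFinset.subtype _) := by
    ext f
    rcases f with e | e <;> simp [F]
  rw [h2, Finset.sum_disjSum, Finset.sum_add_distrib]
  congr 1
  rw [← Finset.sum_filter_add_sum_filter_not h.1.toFinset (fun e => G.IsRegular (G.r e))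
    (fun e => if he : G.IsRegular (G.r e) then φ (Sum.inr ⟨e, he⟩) else 0)]
  have h3 : ∑ e ∈ h.1.toFinset with ¬ G.IsRegular (G.r e),
      (if he : G.IsRegular (G.r e) then φ (Sum.inr ⟨e, he⟩) else 0) = 0 :=
    Finset.sum_eq_zero fun e he => dif_neg (Finset.mem_filter.1 he).2
  rw [h3, add_zero, ← Finset.sum_subtype_eq_sum_filter]
  exact Finset.sum_congr rfl fun e _ => by rw [dif_pos e.2]

theorem isFamily_of :
    IsFamily G.F Set.univ (ofVertex R G) (ofEdge R G) (ofGhost R G) := by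
  have vq : ∀ x y, x ≠ y → vertex R G ∅ x * cohnSum R G y = 0 := by
    intro x y h
    rw [← vertex_mul_cohnSum, ← mul_assoc, vertex_mul_of_ne h, zero_mul]
  have qv : ∀ x y, x ≠ y → cohnSum R G x * vertex R G ∅ y = 0 := by
    intro x y h
    rw [← cohnSum_mul_vertex, mul_assoc, vertex_mul_of_ne h, mul_zero]
  have qq : ∀ x y, x ≠ y → cohnSum R G x * cohnSum R G y = 0 := by
    intro x y h
    rw [← cohnSum_mul_vertex, mul_assoc, vq x y h, mul_zero]
  have ge : ∀ (e : E) (y z : Cohn R G),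
      (y * ghost R G ∅ e) * (edge R G ∅ e * z) = y * (vertex R G ∅ (G.r e) * z) := by
    intro e y z
    rw [mul_assoc, ← mul_assoc (ghost R G ∅ e), ghost_mul_edge]
  have gf : ∀ (e f : E) (y z : Cohn R G), e ≠ f →
      (y * ghost R G ∅ e) * (edge R G ∅ f * z) = 0 := by
    intro e f y z h
    rw [mul_assoc, ← mul_assoc (ghost R G ∅ e), ghost_mul_edge_of_ne h, zero_mul, mul_zero]
  refine ⟨fun x => ?_, fun x y h => ?_, fun e => ?_, fun e => ?_, fun e => ?_, fun e => ?_,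
    fun e => ?_, fun e f h => ?_, fun x _ hx => ?_⟩
  · rcases x with x | x
    · exact cohnSum_mul_self x
    · simp [ofVertex, sub_mul, mul_sub, cohnSum_mul_self, vertex_mul_cohnSum, cohnSum_mul_vertex]
  · rcases x with x | x <;> rcases y with y | y
    · have h : x ≠ y := by simpa using h
      exact qq x y h
    · by_cases h : x = y.1
      · simp [ofVertex, h, mul_sub, cohnSum_mul_self, cohnSum_mul_vertex]
      · simp [ofVertex, mul_sub, qq _ _ h, qv _ _ h]
    · by_cases h : x.1 = y
      · simp [ofVertex, h, sub_mul, cohnSum_mul_self, vertex_mul_cohnSum]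
      · simp [ofVertex, sub_mul, qq _ _ h, vq _ _ h]
    · have h : x.1 ≠ y.1 := by simpa [Subtype.ext_iff] using h
      simp [ofVertex, sub_mul, mul_sub, qq _ _ h, vq _ _ h, qv _ _ h, vertex_mul_of_ne h]
  · rcases e with e | e <;> simp only [ofVertex, ofEdge, F, Sum.elim_inl, Sum.elim_inr] <;>
      rw [← mul_assoc, cohnSum_mul_edge]
  · rcases e with e | e <;>
      simp [ofVertex, ofEdge, F, mul_assoc, sub_mul, mul_sub, cohnSum_mul_self,
        cohnSum_mul_vertex]
  · rcases e with e | e <;>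
      simp only [ofVertex, ofGhost, F, Sum.elim_inl, Sum.elim_inr, ← mul_assoc] <;>
      simp [sub_mul, mul_sub, cohnSum_mul_self, vertex_mul_cohnSum, cohnSum_mul_vertex]
  · rcases e with e | e <;> simp only [ofVertex, ofGhost, F, Sum.elim_inl, Sum.elim_inr] <;>
      rw [mul_assoc, ghost_mul_cohnSum]
  · rcases e with e | e <;>
      simp only [ofVertex, ofGhost, ofEdge, F, ge, Sum.elim_inl, Sum.elim_inr] <;>
      simp [sub_mul, mul_sub, cohnSum_mul_self, vertex_mul_cohnSum, cohnSum_mul_vertex]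
  · rcases e with e | e <;> rcases f with f | f
    · have h : e ≠ f := by simpa using h
      exact gf _ _ _ _ h
    · by_cases h : e = f.1
      · subst h
        simp only [ofGhost, ofEdge, ge]
        simp [sub_mul, mul_sub, cohnSum_mul_self, vertex_mul_cohnSum, cohnSum_mul_vertex]
      · exact gf _ _ _ _ h
    · by_cases h : e.1 = f
      · subst h
        simp only [ofGhost, ofEdge, ge]
        simp [sub_mul, mul_sub, cohnSum_mul_self, vertex_mul_cohnSum, cohnSum_mul_vertex]
      · exact gf _ _ _ _ h
    · have h : e.1 ≠ f.1 := by simpa [Subtype.ext_iff] using h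
      exact gf _ _ _ _ h
  · rcases x with x | x
    · have h := isRegular_F_inl hx
      rw [sum_F h hx]
      simp only [ofVertex]
      rw [cohnSum_of_isRegular h]
      refine Finset.sum_congr rfl fun e _ => ?_
      have key : ∀ q : Cohn R G, q * q = q →
          edge R G ∅ e * q * (q * ghost R G ∅ e) = edge R G ∅ e * (q * ghost R G ∅ e) := by
        intro q hq
        rw [mul_assoc, ← mul_assoc q, hq]
      split_ifs with he
      · simp only [ofEdge, ofGhost]
        rw [key _ (cohnSum_mul_self _), key, ← mul_add, ← add_mul, add_sub_cancel, r_mul_ghost]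
        simp [sub_mul, mul_sub, cohnSum_mul_self, vertex_mul_cohnSum, cohnSum_mul_vertex]
      · simp only [ofEdge, ofGhost, cohnSum_of_not he]
        rw [edge_mul_r, r_mul_ghost, add_zero]
    · exact absurd hx (not_isRegular_F_inr x)

variable (R G)

/-- The homomorphism `L_R(F(G)) → C_R(G)` sending the vertex `v` of `G` to `∑ e e*` (sum over the
edges with source `v`) if `v` is regular and to `v` otherwise, sending `v'` to `v - ∑ e e*`, and
sending an edge `f` of `F(G)` (`f = e` or `f = e'`) to the product of `e` and the image of `r(f)`,
with ghost edges sent to the adjoint elements. -/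
noncomputable def leavittToCohn : Leavitt R G.F →ₙₐ[R] Cohn R G := lift isFamily_of

variable {R G}

theorem leavittToCohn_cohnToLeavitt (y : Cohn R G) :
    leavittToCohn R G (cohnToLeavitt R G y) = y := by
  have h : (leavittToCohn R G).comp (cohnToLeavitt R G) = NonUnitalAlgHom.id R (Cohn R G) := by
    apply hom_ext <;> intro x
    · by_cases hx : G.IsRegular x <;>
        simp [leavittToCohn, cohnToLeavitt, primeVertex, hx, ofVertex, cohnSum_of_not]
    · by_cases hx : G.IsRegular (G.r x) <;>
        simp [leavittToCohn, cohnToLeavitt, primeEdge, hx, ofEdge, cohnSum_of_not, mul_sub]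
    · by_cases hx : G.IsRegular (G.r x) <;>
        simp [leavittToCohn, cohnToLeavitt, primeGhost, hx, ofGhost, cohnSum_of_not, sub_mul]
  exact DFunLike.congr_fun h y

theorem cohnToLeavitt_cohnSum (x : V) :
    cohnToLeavitt R G (cohnSum R G x) = vertex R G.F Set.univ (Sum.inl x) := by
  by_cases hx : G.IsRegular x
  · rw [cohnSum_of_isRegular hx, map_sum, vertex_eq_sum (Set.mem_univ _) hx.F_inl, sum_F hx hx.F_inl]
    refine Finset.sum_congr rfl fun e _ => ?_
    have h1 : edge R G.F Set.univ (Sum.inl e) * primeGhost R G e = 0 := by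
      unfold primeGhost
      split_ifs with he
      · rw [← edge_mul_r, mul_assoc, ← r_mul_ghost, ← mul_assoc (vertex _ _ _ _),
          vertex_mul_of_ne (by simp [F]), zero_mul, mul_zero]
      · simp
    have h2 : primeEdge R G e * ghost R G.F Set.univ (Sum.inl e) = 0 := by
      unfold primeEdge
      split_ifs with he
      · rw [← edge_mul_r, mul_assoc, ← r_mul_ghost, ← mul_assoc (vertex _ _ _ _),
          vertex_mul_of_ne (by simp [F]), zero_mul, mul_zero]
      · simp
    rw [map_mul]
    simp only [cohnToLeavitt, lift_edge, lift_ghost, add_mul, mul_add, h1, h2, add_zero, zero_add]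
    congr 1
    by_cases he : G.IsRegular (G.r e) <;> simp [primeEdge, primeGhost, he]
  · rw [cohnSum_of_not hx]
    simp [cohnToLeavitt, primeVertex, hx]

theorem cohnToLeavitt_leavittToCohn (y : Leavitt R G.F) :
    cohnToLeavitt R G (leavittToCohn R G y) = y := by
  have hv : ∀ x, cohnToLeavitt R G (ofVertex R G x) = vertex R G.F Set.univ x := by
    intro x
    rcases x with x | x
    · exact cohnToLeavitt_cohnSum x
    · simp only [ofVertex, map_sub, cohnToLeavitt_cohnSum]
      simp [cohnToLeavitt, primeVertex, x.2]
  have he : ∀ e, cohnToLeavitt R G (edge R G ∅ e) =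
      edge R G.F Set.univ (Sum.inl e) + primeEdge R G e := fun e => lift_edge _ e
  have hg : ∀ e, cohnToLeavitt R G (ghost R G ∅ e) =
      ghost R G.F Set.univ (Sum.inl e) + primeGhost R G e := fun e => lift_ghost _ e
  have o1 : ∀ {e f : E ⊕ {e : E // G.IsRegular (G.r e)}}, G.F.r e ≠ G.F.r f →
      edge R G.F Set.univ e * vertex R G.F Set.univ (G.F.r f) = 0 := by
    intro e f h
    rw [← edge_mul_r, mul_assoc, vertex_mul_of_ne h, mul_zero]
  have o2 : ∀ {e f : E ⊕ {e : E // G.IsRegular (G.r e)}}, G.F.r f ≠ G.F.r e →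
      vertex R G.F Set.univ (G.F.r f) * ghost R G.F Set.univ e = 0 := by
    intro e f h
    rw [← r_mul_ghost, ← mul_assoc, vertex_mul_of_ne h, zero_mul]
  have h : (cohnToLeavitt R G).comp (leavittToCohn R G) =
      NonUnitalAlgHom.id R (Leavitt R G.F) := by
    apply hom_ext <;> intro x
    · simpa [leavittToCohn] using hv x
    · have h1 : ofEdge R G x = edge R G ∅ (Sum.elim id Subtype.val x) *
          ofVertex R G (G.F.r x) := by
        rcases x with x | x <;> rfl
      simp only [NonUnitalAlgHom.comp_apply, leavittToCohn, lift_edge, h1, map_mul, hv, he]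
      rcases x with x | x
      · simp only [Sum.elim_inl, id, add_mul, edge_mul_r]
        unfold primeEdge
        split_ifs with h
        · rw [o1 (by simp [F])]
          simp
        · simp
      · simp only [Sum.elim_inr, add_mul]
        rw [o1 (by simp [F])]
        simp [primeEdge, x.2]
    · have h1 : ofGhost R G x = ofVertex R G (G.F.r x) *
          ghost R G ∅ (Sum.elim id Subtype.val x) := by
        rcases x with x | x <;> rfl
      simp only [NonUnitalAlgHom.comp_apply, leavittToCohn, lift_ghost, h1, map_mul, hv, hg]
      rcases x with x | x
      · simp only [Sum.elim_inl, id, mul_add, r_mul_ghost]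
        unfold primeGhost
        split_ifs with h
        · rw [o2 (by simp [F])]
          simp
        · simp
      · simp only [Sum.elim_inr, mul_add]
        rw [o2 (by simp [F])]
        simp [primeGhost, x.2]
  exact DFunLike.congr_fun h y

theorem cohnToLeavitt_star (y : Cohn R G) :
    cohnToLeavitt R G (star y) = star (cohnToLeavitt R G y) := by
  let f : Cohn R G →ₙₐ[R] Leavitt R G.F :=
    { toFun := fun y => star (cohnToLeavitt R G (star y))
      map_zero' := by simp
      map_add' := by simp
      map_mul' := by simp
      map_smul' := by simp [star_smul'] }
  have hf : f = cohnToLeavitt R G := by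
    apply hom_ext <;> intro x
    · by_cases hx : G.IsRegular x <;> simp [f, cohnToLeavitt, primeVertex, hx]
    · by_cases hx : G.IsRegular (G.r x) <;>
        simp [f, cohnToLeavitt, primeEdge, primeGhost, hx]
    · by_cases hx : G.IsRegular (G.r x) <;>
        simp [f, cohnToLeavitt, primeEdge, primeGhost, hx]
  have h2 : star (cohnToLeavitt R G (star y)) = cohnToLeavitt R G y := DFunLike.congr_fun hf y
  rw [← h2, star_star]

variable (R G)

/-- The standard isomorphism of `*`-algebras `C_R(G) ≅ L_R(F(G))`. -/
noncomputable def cohnEquivLeavitt : Cohn R G ≃⋆ₐ[R] Leavitt R G.F where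
  toFun := cohnToLeavitt R G
  invFun := leavittToCohn R G
  left_inv := leavittToCohn_cohnToLeavitt
  right_inv := cohnToLeavitt_leavittToCohn
  map_mul' := map_mul (cohnToLeavitt R G)
  map_add' := map_add (cohnToLeavitt R G)
  map_star' := cohnToLeavitt_star
  map_smul' := map_smul (cohnToLeavitt R G)

end CohnIso

end DirGraph

/-! The substance is (iii) ⇒ (i), by a reduction theorem (`exists_mul_mul_eq_smul_ofVertex`): every
y ≠ 0 in the Cohn algebra admits a, b with ayb = t·w, where t ≠ 0 and w is the image of a vertex of
F(E). If Φ(y) = 0, then Φ(tw) = Φ(a)Φ(y)Φ(b) = 0, contradicting (iii). The scalar stays inside Φ, so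
no linearity of Φ over R is needed.

For the reduction, write y as a combination of monomials αβ* (`span_monomial_pathPairs`) and pick a
term with nonzero coefficient for which |β|, and then |α|, is minimal. Multiplying by α* on the left
and β on the right turns this term into its range vertex x, but terms whose paths extend α or β may
survive. They are removed by an element g = xg that is killed on the left by every ghost edge of the
finitely many edges occurring in y (`exists_annihilated`). If x is regular, g is the gap x - ∑ ee*;
if x is an infinite emitter, g is an edge that does not occur in y; if x is a sink, g = x. The
absence of (CK-2) supplies the gap, so cycles without exits need no separate treatment.

For (ii) ⇒ (iii), each vertex of F(E) lies in the core, and its nonzero multiples are nonzero. The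
latter is seen in a representation by adding and deleting first edges of paths, where the gap at x
fixes the trivial path at x. -/

namespace DirGraph

namespace PathAlgebra

/-! ### Monomials αβ* and cancellation of paths -/

section Monomials

variable (R : Type*) [CommRing R] {V E : Type*} (G : DirGraph V E) (X : Set V)

/-- The product `e₁ ⋯ eₙ x` in the path algebra; it vanishes unless `e₁, …, eₙ` is a path
ending at `x`. -/
noncomputable def pathTo : List E → V → PathAlgebra R G X
  | [], x => vertex R G X x
  | e :: l, x => edge R G X e * pathTo l x

/-- The monomial `αβ*`, where `α` and `β` are viewed as paths ending at the same vertex. -/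
noncomputable def monomial (i : List E × V × List E) : PathAlgebra R G X :=
  pathTo R G X i.1 i.2.1 * star (pathTo R G X i.2.2 i.2.1)

variable {R G X}

theorem edge_mul_of_ne {e : E} {x : V} (h : G.r e ≠ x) :
    edge R G X e * vertex R G X x = 0 := by
  rw [← edge_mul_r, mul_assoc, vertex_mul_of_ne h, mul_zero]

theorem vertex_mul_edge_of_ne {e : E} {x : V} (h : x ≠ G.s e) :
    vertex R G X x * edge R G X e = 0 := by
  rw [← s_mul_edge, ← mul_assoc, vertex_mul_of_ne h, zero_mul]

theorem ghost_mul_of_ne {e : E} {x : V} (h : G.s e ≠ x) :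
    ghost R G X e * vertex R G X x = 0 := by
  rw [← ghost_mul_s, mul_assoc, vertex_mul_of_ne h, mul_zero]

theorem vertex_mul_pathTo {z x : V} {l : List E} (h : G.IsPath z l x) :
    vertex R G X z * pathTo R G X l x = pathTo R G X l x := by
  cases l with
  | nil => cases h; exact vertex_mul_self _
  | cons e l => rw [← h.1, pathTo, ← mul_assoc, s_mul_edge]

theorem vertex_mul_pathTo_eq_or (z x : V) (l : List E) :
    vertex R G X z * pathTo R G X l x = pathTo R G X l x ∨
      vertex R G X z * pathTo R G X l x = 0 := by
  cases l with
  | nil =>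
    by_cases h : z = x
    · subst h; exact .inl (vertex_mul_self _)
    · exact .inr (vertex_mul_of_ne h)
  | cons e l =>
    by_cases h : z = G.s e
    · subst h; left; rw [pathTo, ← mul_assoc, s_mul_edge]
    · right; rw [pathTo, ← mul_assoc, vertex_mul_edge_of_ne h, zero_mul]

theorem pathTo_append_singleton (l : List E) (e : E) :
    pathTo R G X (l ++ [e]) (G.r e) = pathTo R G X l (G.s e) * edge R G X e := by
  induction l with
  | nil => simp [pathTo]
  | cons f l ih => rw [List.cons_append, pathTo, ih, pathTo, mul_assoc]

/-- Two consecutive edges that do not match multiply to e r(e) s(f) f = 0. Arbitrary lists may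
therefore index monomials, and those that are not paths are discarded later. -/
theorem pathTo_eq_zero {l : List E} {x : V} (h : ∀ z, ¬ G.IsPath z l x) :
    pathTo R G X l x = 0 := by
  induction l with
  | nil => exact absurd rfl (h x)
  | cons e l ih =>
    by_cases h' : G.IsPath (G.r e) l x
    · exact absurd ⟨rfl, h'⟩ (h (G.s e))
    · rw [pathTo]
      cases l with
      | nil => exact edge_mul_of_ne h'
      | cons f l =>
        by_cases hf : G.r e = G.s f
        · rw [ih, mul_zero]
          intro z hz
          exact h' ⟨hf.symm, hz.2⟩
        · rw [pathTo, ← mul_assoc, ← edge_mul_r e, mul_assoc (edge R G X e),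
            vertex_mul_edge_of_ne hf, mul_zero, zero_mul]

theorem edge_mul_monomial (e : E) (i : List E × V × List E) :
    edge R G X e * monomial R G X i = monomial R G X (e :: i.1, i.2) := by
  simp only [monomial, pathTo, mul_assoc]

theorem vertex_mul_monomial_mem (z : V) (i : List E × V × List E) :
    vertex R G X z * monomial R G X i ∈ Submodule.span R (Set.range (monomial R G X)) := by
  rw [monomial, ← mul_assoc]
  rcases vertex_mul_pathTo_eq_or (R := R) (G := G) (X := X) z i.2.1 i.1 with h | h <;> rw [h]
  · exact Submodule.subset_span ⟨i, rfl⟩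
  · rw [zero_mul]; exact zero_mem _

/-- A ghost edge either cancels against the first edge of α by (CK-1) or, when α is trivial, is
absorbed into β*. -/
theorem ghost_mul_monomial_mem (e : E) (i : List E × V × List E) :
    ghost R G X e * monomial R G X i ∈ Submodule.span R (Set.range (monomial R G X)) := by
  obtain ⟨l, x, m⟩ := i
  cases l with
  | nil =>
    by_cases h : G.s e = x
    · subst h
      -- With α trivial at s(e), e*β* = (βe)*, so the ghost path grows at its range end.
      refine Submodule.subset_span ⟨([], G.r e, m ++ [e]), ?_⟩
      simp only [monomial, pathTo, pathTo_append_singleton, star_mul, star_edge]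
      rw [← mul_assoc, ← mul_assoc, r_mul_ghost, ghost_mul_s]
    · rw [monomial, pathTo, ← mul_assoc, ghost_mul_of_ne h, zero_mul]
      exact zero_mem _
  | cons f l =>
    rw [← edge_mul_monomial f (l, x, m), ← mul_assoc]
    by_cases h : e = f
    · subst h
      rw [ghost_mul_edge]
      exact vertex_mul_monomial_mem _ _
    · rw [ghost_mul_edge_of_ne h, zero_mul]
      exact zero_mem _

theorem mk_gen_mul_mem (g : Gen V E) {y : PathAlgebra R G X}
    (hy : y ∈ Submodule.span R (Set.range (monomial R G X))) :
    mk (gen R g) * y ∈ Submodule.span R (Set.range (monomial R G X)) := by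
  induction hy using Submodule.span_induction with
  | mem y hy =>
    obtain ⟨i, rfl⟩ := hy
    cases g with
    | vertex x => exact vertex_mul_monomial_mem x i
    | edge e => exact Submodule.subset_span ⟨_, (edge_mul_monomial e i).symm⟩
    | ghost e => exact ghost_mul_monomial_mem e i
  | zero => rw [mul_zero]; exact zero_mem _
  | add y z _ _ hy hz => rw [mul_add]; exact add_mem hy hz
  | smul t y _ hy => rw [mul_smul_comm]; exact Submodule.smul_mem _ _ hy

theorem vertex_mem_span (x : V) :
    vertex R G X x ∈ Submodule.span R (Set.range (monomial R G X)) :=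
  Submodule.subset_span ⟨([], x, []), by simp [monomial, pathTo]⟩

theorem mk_gen_mem_span (g : Gen V E) :
    (mk (gen R g) : PathAlgebra R G X) ∈ Submodule.span R (Set.range (monomial R G X)) := by
  cases g with
  | vertex x => exact vertex_mem_span x
  | edge e =>
    have h := mk_gen_mul_mem (Gen.edge e) (vertex_mem_span (R := R) (G := G) (X := X) (G.r e))
    rwa [← edge, edge_mul_r] at h
  | ghost e =>
    have h := mk_gen_mul_mem (Gen.ghost e) (vertex_mem_span (R := R) (G := G) (X := X) (G.s e))
    rwa [← ghost, ghost_mul_s] at h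

/-- Words span the free algebra, and left multiplication by a generator preserves the span of the
monomials, so induction on the length of the word suffices. -/
theorem span_monomial : Submodule.span R (Set.range (monomial R G X)) = ⊤ := by
  rw [eq_top_iff]
  rintro y -
  obtain ⟨a, rfl⟩ := mk_surjective y
  induction a using MonoidAlgebra.induction_linear with
  | zero => rw [mk_zero]; exact zero_mem _
  | add a b ha hb => rw [mk_add]; exact add_mem ha hb
  | single w t =>
    have h : (MonoidAlgebra.single w t : FreeAlg R V E) = t • MonoidAlgebra.single w 1 := by simp
    rw [h, mk_smul]
    refine Submodule.smul_mem _ _ ?_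
    induction w using FreeSemigroup.recOnMul with
    | ih1 g => exact mk_gen_mem_span g
    | ih2 g w _ hw =>
      have h : (MonoidAlgebra.single (FreeSemigroup.of g * w) 1 : FreeAlg R V E) =
          gen R g * MonoidAlgebra.single w 1 := by
        simp [gen]
      rw [h, mk_mul]
      exact mk_gen_mul_mem g (hw (by simp))

variable (G) in
/-- The index triples `(α, x, β)` for which `α` and `β` are paths ending at `x`. -/
def pathPairs : Set (List E × V × List E) :=
  {i | (∃ z, G.IsPath z i.1 i.2.1) ∧ ∃ z, G.IsPath z i.2.2 i.2.1}

theorem span_monomial_pathPairs :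
    Submodule.span R (monomial R G X '' pathPairs G) = ⊤ := by
  rw [eq_top_iff, ← span_monomial, Submodule.span_le]
  rintro _ ⟨i, rfl⟩
  by_cases h : i ∈ pathPairs G
  · exact Submodule.subset_span ⟨i, h, rfl⟩
  · have h0 : monomial R G X i = 0 := by
      rw [pathPairs, Set.mem_ofPred_eq, not_and_or, not_exists, not_exists] at h
      rcases h with h | h <;> simp [monomial, pathTo_eq_zero h]
    rw [h0]
    exact zero_mem _

theorem star_pathTo_mul_pathTo {z x : V} {l : List E} (h : G.IsPath z l x)
    {g : PathAlgebra R G X} (hg : vertex R G X x * g = g) :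
    star (pathTo R G X l x) * (pathTo R G X l x * g) = g := by
  induction l generalizing z with
  | nil => simp [pathTo, hg]
  | cons e l ih =>
    simp only [pathTo, star_mul, star_edge]
    rw [mul_assoc, mul_assoc (edge R G X e), ← mul_assoc (ghost R G X e), ghost_mul_edge,
      ← mul_assoc (vertex R G X _), vertex_mul_pathTo h.2, ih h.2]

/-- Equal first edges cancel, and the first disagreement gives 0 by (CK-1). If `l₀` is used up
first, the next edge of `l` meets `g` as a ghost and kills it; if both end together, the end
vertices differ and are orthogonal. The length bound excludes the remaining case, a proper initial
segment `l` of `l₀`. -/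
theorem star_pathTo_mul_pathTo_of_ne {z₀ x₀ x : V} {l₀ l : List E}
    (h₀ : G.IsPath z₀ l₀ x₀) (hl : l₀.length ≤ l.length) (hne : (x, l) ≠ (x₀, l₀))
    {g : PathAlgebra R G X} (hg : vertex R G X x₀ * g = g)
    (hgl : ∀ e ∈ l, ghost R G X e * g = 0) :
    star (pathTo R G X l x) * (pathTo R G X l₀ x₀ * g) = 0 := by
  induction l₀ generalizing l z₀ with
  | nil =>
    rw [pathTo, hg]
    cases l with
    | nil =>
      have h : x ≠ x₀ := by simpa using hne
      rw [pathTo, star_vertex, ← hg, ← mul_assoc, vertex_mul_of_ne h, zero_mul]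
    | cons e l => rw [pathTo, star_mul, star_edge, mul_assoc, hgl e (by simp), mul_zero]
  | cons e₀ l₀ ih =>
    cases l with
    | nil => simp at hl
    | cons e l =>
      simp only [pathTo, star_mul, star_edge]
      rw [mul_assoc, mul_assoc (edge R G X e₀), ← mul_assoc (ghost R G X e)]
      by_cases h : e = e₀
      · subst h
        rw [ghost_mul_edge, ← mul_assoc (vertex R G X _), vertex_mul_pathTo h₀.2]
        exact ih h₀.2 (by simpa using hl) (by simpa using hne)
          fun f hf => hgl f (List.mem_cons_of_mem _ hf)
      · rw [ghost_mul_edge_of_ne h, zero_mul, mul_zero]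

end Monomials

/-! ### Reduction to vertices of F(E) -/

section Reduction

variable {R : Type*} [CommRing R] {V E : Type*} {G : DirGraph V E}

/-- By (CK-1), e* ∑ ff* = e* when s(e) is regular. At a nonregular vertex the difference is itself
zero. -/
theorem ghost_mul_vertex_sub_cohnSum (e : E) (x : V) :
    ghost R G ∅ e * (vertex R G ∅ x - cohnSum R G x) = 0 := by
  by_cases h : G.s e = x
  · subst h
    rw [mul_sub, ghost_mul_s, ghost_mul_cohnSum, sub_self]
  · rw [mul_sub, ← vertex_mul_cohnSum, ← mul_assoc, ghost_mul_of_ne h, zero_mul, sub_self]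

theorem star_cohnSum (x : V) : star (cohnSum R G x) = cohnSum R G x := by
  unfold cohnSum
  split_ifs <;> simp

/-- A regular vertex of E is the sum v + v' in F(E) and must be cut down to one summand, here v'; a
nonregular one is already a vertex of F(E). -/
theorem exists_vertex_mul_eq_ofVertex (x : V) :
    ∃ u z, vertex R G ∅ x * u = ofVertex R G z := by
  by_cases h : G.IsRegular x
  · exact ⟨vertex R G ∅ x - cohnSum R G x, Sum.inr ⟨x, h⟩, by
      simp [ofVertex, mul_sub, vertex_mul_cohnSum]⟩
  · exact ⟨vertex R G ∅ x, Sum.inl x, by simp [ofVertex, cohnSum_of_not h]⟩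

/-- An element supported at `x` that is annihilated on the left by the ghost edges in a given
finite set, and from which a vertex of `F(G)` can be recovered. -/
theorem exists_annihilated (x : V) (T : Finset E) :
    ∃ g u : Cohn R G, ∃ z, vertex R G ∅ x * g = g ∧ (∀ e ∈ T, ghost R G ∅ e * g = 0) ∧
      star g * g * u = ofVertex R G z := by
  by_cases hx : G.IsRegular x
  -- The gap is a self-adjoint idempotent, so g*g is already x'. The factor x on the right replaces
  -- a missing unit.
  · refine ⟨vertex R G ∅ x - cohnSum R G x, vertex R G ∅ x, Sum.inr ⟨x, hx⟩, ?_,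
      fun e _ => ghost_mul_vertex_sub_cohnSum e x, ?_⟩
    · rw [mul_sub, vertex_mul_self, vertex_mul_cohnSum]
    · simp [ofVertex, star_cohnSum, sub_mul, mul_sub, cohnSum_mul_self, vertex_mul_cohnSum,
        cohnSum_mul_vertex]
  · by_cases hs : {e | G.s e = x}.Nonempty
    · have hinf : {e | G.s e = x}.Infinite := fun hf => hx ⟨hf, hs⟩
      -- At an infinite emitter some edge f avoids `T`; it is orthogonal to the edges in `T`, and
      -- f*f = r(f).
      obtain ⟨f, hf, hfT⟩ := hinf.exists_notMem_finset T
      obtain ⟨u, z, huz⟩ := exists_vertex_mul_eq_ofVertex (R := R) (G := G) (G.r f)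
      have hf : G.s f = x := hf
      refine ⟨edge R G ∅ f, u, z, ?_, fun e he => ?_, ?_⟩
      · rw [← hf, s_mul_edge]
      · exact ghost_mul_edge_of_ne fun h => hfT (h ▸ he)
      · rw [star_edge, ghost_mul_edge, huz]
    -- At a sink every ghost edge kills x, because no edge starts there.
    · obtain ⟨u, z, huz⟩ := exists_vertex_mul_eq_ofVertex (R := R) (G := G) x
      refine ⟨vertex R G ∅ x, u, z, vertex_mul_self x, fun e _ => ?_, ?_⟩
      · exact ghost_mul_of_ne fun h => hs ⟨e, h⟩
      · rw [star_vertex, vertex_mul_self, huz]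

/-- Reduction theorem: every nonzero element of the Cohn path algebra can be multiplied to a
nonzero scalar multiple of a vertex of `F(G)`. -/
theorem exists_mul_mul_eq_smul_ofVertex {y : Cohn R G} (hy : y ≠ 0) :
    ∃ (a b : Cohn R G) (t : R) (z : V ⊕ {x : V // G.IsRegular x}),
      t ≠ 0 ∧ a * y * b = t • ofVertex R G z := by
  classical
  have hmem : y ∈ Submodule.span R (monomial R G ∅ '' pathPairs G) := by
    rw [span_monomial_pathPairs]; trivial
  obtain ⟨c, hc, rfl⟩ := (Finsupp.mem_span_image_iff_linearCombination R).1 hmem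
  rw [Finsupp.mem_supported] at hc
  have hne : c.support.Nonempty := by
    rw [Finsupp.support_nonempty_iff]
    rintro rfl
    exact hy (map_zero _)
  -- Ghost length comes first: a term with another β' is killed on the right because |β| ≤ |β'|, and
  -- a term with the same β is killed on the left because then |α| ≤ |α'|.
  obtain ⟨i, hi, hmin⟩ := c.support.exists_min_image
    (fun i => toLex (i.2.2.length, i.1.length)) hne
  obtain ⟨α, x, β⟩ := i
  obtain ⟨⟨z₁, hα⟩, ⟨z₂, hβ⟩⟩ := hc hi
  dsimp only at hα hβ
  obtain ⟨g, u, z, hxg, hT, hz⟩ := exists_annihilated (R := R) (G := G) x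
    (c.support.biUnion fun i => i.1.toFinset ∪ i.2.2.toFinset)
  refine ⟨star (pathTo R G ∅ α x * g), pathTo R G ∅ β x * g * u, c (α, x, β), z,
    Finsupp.mem_support_iff.1 hi, ?_⟩
  -- The left factor is written as a star so that both sides have the form γ*(δg) treated by the
  -- cancellation lemmas.
  have key : ∀ j : List E × V × List E,
      star (pathTo R G ∅ α x * g) * monomial R G ∅ j * (pathTo R G ∅ β x * g * u) =
        star (star (pathTo R G ∅ j.1 j.2.1) * (pathTo R G ∅ α x * g)) *
          (star (pathTo R G ∅ j.2.2 j.2.1) * (pathTo R G ∅ β x * g)) * u := by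
    intro j
    simp only [monomial, star_mul, star_star, mul_assoc]
  rw [Finsupp.linearCombination_apply, Finsupp.sum, Finset.mul_sum, Finset.sum_mul,
    Finset.sum_eq_single (α, x, β)]
  · rw [mul_smul_comm, smul_mul_assoc, key, star_pathTo_mul_pathTo hα hxg,
      star_pathTo_mul_pathTo hβ hxg, hz]
  · rintro ⟨α', x', β'⟩ hj hji
    have hlex := hmin _ hj
    rw [Prod.Lex.toLex_le_toLex] at hlex
    dsimp only at hlex
    rw [mul_smul_comm, smul_mul_assoc, key]
    by_cases h : (x', β') = (x, β)
    · obtain ⟨rfl, rfl⟩ := Prod.mk.inj h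
      have h1 : star (pathTo R G ∅ α' x') * (pathTo R G ∅ α x' * g) = 0 := by
        refine star_pathTo_mul_pathTo_of_ne hα (by omega) ?_ hxg fun e he => hT e ?_
        · intro h'
          apply hji
          rw [(Prod.mk.inj h').2]
        · exact Finset.mem_biUnion.2 ⟨_, hj, by simp [he]⟩
      rw [h1, star_zero, zero_mul, zero_mul, smul_zero]
    · have h1 : star (pathTo R G ∅ β' x') * (pathTo R G ∅ β x * g) = 0 := by
        refine star_pathTo_mul_pathTo_of_ne hβ (by omega) h hxg fun e he => hT e ?_
        exact Finset.mem_biUnion.2 ⟨_, hj, by simp [he]⟩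
      rw [h1, mul_zero, zero_mul, smul_zero]
  · exact fun h => absurd hi h

end Reduction

/-! ### A path representation and nonvanishing of vertices -/

section Representation

variable (R : Type*) [CommRing R] {V E : Type*} (G : DirGraph V E)

/-- The source of the sequence of edges `l` ending at `x`. -/
def pathSource : V × List E → V
  | (x, []) => x
  | (_, e :: _) => G.s e

open scoped Classical in
/-- The projection onto the span of the paths with source `x`. -/
noncomputable def vertexOp (x : V) : Module.End R (V × List E →₀ R) :=
  Finsupp.linearCombination R fun i => if pathSource G i = x then Finsupp.single i 1 else 0

open scoped Classical in
/-- Prepending the edge `e` to paths with source `r(e)`. -/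
noncomputable def edgeOp (e : E) : Module.End R (V × List E →₀ R) :=
  Finsupp.linearCombination R fun i =>
    if pathSource G i = G.r e then Finsupp.single (i.1, e :: i.2) 1 else 0

open scoped Classical in
/-- Deleting the first edge of a path if it equals `e`. -/
noncomputable def ghostOp (e : E) : Module.End R (V × List E →₀ R) :=
  Finsupp.linearCombination R fun i =>
    match i with
    | (_, []) => 0
    | (x, f :: l) => if e = f ∧ pathSource G (x, l) = G.r e then Finsupp.single (x, l) 1 else 0

open scoped Classical in
theorem vertexOp_single (x : V) (i : V × List E) :
    vertexOp R G x (Finsupp.single i 1) =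
      if pathSource G i = x then Finsupp.single i 1 else 0 := by
  simp [vertexOp]

open scoped Classical in
theorem edgeOp_single (e : E) (i : V × List E) :
    edgeOp R G e (Finsupp.single i 1) =
      if pathSource G i = G.r e then Finsupp.single (i.1, e :: i.2) 1 else 0 := by
  simp [edgeOp]

theorem ghostOp_single_nil (e : E) (x : V) :
    ghostOp R G e (Finsupp.single (x, []) 1) = 0 := by
  simp [ghostOp]

open scoped Classical in
theorem ghostOp_single_cons (e f : E) (x : V) (l : List E) :
    ghostOp R G e (Finsupp.single (x, f :: l) 1) =
      if e = f ∧ pathSource G (x, l) = G.r e then Finsupp.single (x, l) 1 else 0 := by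
  simp [ghostOp]

variable {R} in
theorem end_ext {p q : Module.End R (V × List E →₀ R)}
    (h : ∀ i, p (Finsupp.single i 1) = q (Finsupp.single i 1)) : p = q :=
  Finsupp.lhom_ext' fun i => LinearMap.ext_ring (h i)

/-- All pairs (x, l) serve as a basis, including lists that are not paths: the relations see only
the first edge and the source of what follows. This is why `ghostOp` also tests the source of the
tail. -/
theorem isFamily_op_paths : IsFamily G ∅ (vertexOp R G) (edgeOp R G) (ghostOp R G) := by
  classical
  refine ⟨fun x => end_ext fun i => ?_, fun x y h => end_ext fun i => ?_,
    fun e => end_ext fun i => ?_, fun e => end_ext fun i => ?_, fun e => end_ext fun i => ?_,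
    fun e => end_ext fun i => ?_, fun e => end_ext fun i => ?_,
    fun e f h => end_ext fun i => ?_, fun x hX => absurd hX (Set.notMem_empty x)⟩
  · rw [Module.End.mul_apply, vertexOp_single]
    split_ifs with h <;> simp [vertexOp_single, h]
  · rw [Module.End.mul_apply, vertexOp_single]
    split_ifs with h' <;> simp [vertexOp_single, h', h.symm]
  · rw [Module.End.mul_apply, edgeOp_single]
    split_ifs with h <;> simp [vertexOp_single, pathSource]
  · rw [Module.End.mul_apply, vertexOp_single]
    split_ifs with h <;> simp [edgeOp_single, h]
  · rcases i with ⟨x, _ | ⟨f, l⟩⟩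
    · simp [ghostOp_single_nil]
    · rw [Module.End.mul_apply, ghostOp_single_cons]
      split_ifs with h <;> simp [vertexOp_single, h]
  · rcases i with ⟨x, _ | ⟨f, l⟩⟩
    · rw [Module.End.mul_apply, vertexOp_single]
      split_ifs <;> simp [ghostOp_single_nil]
    · rw [Module.End.mul_apply, vertexOp_single, pathSource]
      split_ifs with h
      · rfl
      · rw [map_zero, ghostOp_single_cons, if_neg]
        rintro ⟨rfl, -⟩
        exact h rfl
  · rw [Module.End.mul_apply, edgeOp_single, vertexOp_single]
    split_ifs with h <;> simp [ghostOp_single_cons, h]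
  · rw [Module.End.mul_apply, edgeOp_single]
    split_ifs with h' <;> simp [ghostOp_single_cons, h]

variable {G}

theorem smul_vertex_ne_zero {t : R} (ht : t ≠ 0) (x : V) : t • vertex R G ∅ x ≠ 0 := by
  intro h
  have h1 := congrArg (lift (isFamily_op_paths R G)) h
  rw [map_smul, map_zero, lift_vertex] at h1
  have h2 := LinearMap.congr_fun h1 (Finsupp.single (x, []) 1)
  exact ht (by simpa [vertexOp_single, pathSource] using h2)

/-- For regular v, e*(∑ ff*)e = r(e) reduces the sum to an ordinary vertex. The gap v' fixes the
trivial path at v, since ghost edges annihilate it. -/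
theorem smul_ofVertex_ne_zero {t : R} (ht : t ≠ 0) (z : V ⊕ {x : V // G.IsRegular x}) :
    t • ofVertex R G z ≠ 0 := by
  intro h
  rcases z with x | ⟨x, hx⟩
  · simp only [ofVertex] at h
    by_cases hx : G.IsRegular x
    · obtain ⟨e, rfl⟩ := hx.2
      apply smul_vertex_ne_zero (G := G) R ht (G.r e)
      calc t • vertex R G ∅ (G.r e)
          = ghost R G ∅ e * (t • cohnSum R G (G.s e)) * edge R G ∅ e := by
            rw [mul_smul_comm, ghost_mul_cohnSum, smul_mul_assoc, ghost_mul_edge]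
        _ = 0 := by rw [h, mul_zero, zero_mul]
    · rw [cohnSum_of_not hx] at h
      exact smul_vertex_ne_zero R ht x h
  · have h1 := congrArg (lift (isFamily_op_paths R G)) h
    simp only [ofVertex] at h1
    rw [cohnSum_of_isRegular hx, map_smul, map_zero, map_sub, map_sum, lift_vertex] at h1
    have h2 := LinearMap.congr_fun h1 (Finsupp.single (x, []) 1)
    exact ht (by simpa [vertexOp_single, pathSource, LinearMap.sum_apply, ghostOp_single_nil]
      using h2)

end Representation

end PathAlgebra

/-! ### Vertices in the core, and the equivalence -/

open PathAlgebra

theorem cohnEquivLeavitt_symm_vertex {R : Type*} [CommRing R] {V E : Type*} {G : DirGraph V E}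
    (z : V ⊕ {x : V // G.IsRegular x}) :
    (cohnEquivLeavitt R G).symm (vertex R G.F Set.univ z) = ofVertex R G z :=
  lift_vertex isFamily_of z

/-- A vertex is αβ* for two trivial paths, and it is self-adjoint, hence normal. -/
theorem vertex_mem_commutativeCore {R : Type*} [CommRing R] {V E : Type*} (G : DirGraph V E)
    (x : V) : vertex R G Set.univ x ∈ commutativeCore R G := by
  refine NonUnitalAlgebra.subset_adjoin R ⟨x, x, x, [], [], rfl, rfl, ?_, ⟨?_⟩⟩
  · simp [pathElem]
  · simp [Commute, SemiconjBy]

end DirGraph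

theorem mainTheorem10 {R : Type*} [CommRing R] {V E : Type*} (G : DirGraph V E)
    {A : Type*} [NonUnitalRing A] (Φ : DirGraph.Cohn R G →ₙ+* A) :
    List.TFAE [
      Function.Injective Φ,
      Set.InjOn Φ ((DirGraph.cohnEquivLeavitt R G).symm ''
        (DirGraph.commutativeCore R G.F : Set (DirGraph.Leavitt R G.F))),
      ∀ (x : V ⊕ {x : V // G.IsRegular x}) (t : R), t ≠ 0 →
        Φ (t • (DirGraph.cohnEquivLeavitt R G).symm
          (DirGraph.PathAlgebra.vertex R G.F Set.univ x)) ≠ 0] := by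
  tfae_have 1 → 2 := fun h => h.injOn
  tfae_have 2 → 3 := by
    intro h x t ht h0
    apply DirGraph.PathAlgebra.smul_ofVertex_ne_zero (G := G) R ht x
    rw [← DirGraph.cohnEquivLeavitt_symm_vertex]
    -- Injectivity on the core is used for the pair t·w and 0, both in its image.
    refine h ⟨t • DirGraph.PathAlgebra.vertex R G.F Set.univ x, ?_, map_smul _ _ _⟩
      ⟨0, zero_mem _, map_zero _⟩ (h0.trans (map_zero Φ).symm)
    exact SMulMemClass.smul_mem t (DirGraph.vertex_mem_commutativeCore G.F x)
  tfae_have 3 → 1 := by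
    intro h
    rw [injective_iff_map_eq_zero]
    intro y hy
    by_contra hne
    obtain ⟨a, b, t, z, ht, hab⟩ :=
      DirGraph.PathAlgebra.exists_mul_mul_eq_smul_ofVertex hne
    apply h z t ht
    rw [DirGraph.cohnEquivLeavitt_symm_vertex, ← hab, map_mul, map_mul, hy, mul_zero, zero_mul]
  tfae_finish
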